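/- Conventions. $\mathcal H^k$ is the $k$-dimensional Hausdorff measure on $\mathbb R^d$, normalized to agree with Lebesgue measure on $\mathbb R^k$. Let $\Sigma$ be a simplex soup, i.e. a finite family of (nondegenerate) simplices of $\mathbb R^d$; $d_\sigma$ is the dimension of $\sigma\in\Sigma$, $\sigma^0$ the linear subspace tangent to $\sigma$, $\Pi_{\sigma^0}:\mathbb R^d\to\sigma^0$ the orthogonal projection, and $K=\bigcup_{\sigma\in\Sigma}\sigma$. A simplicial measure on $\Sigma$ with densities $\rho_\sigma\ge 0$ is a measure $\mu$ with $\mu(B)=\sum_{\sigma\in\Sigma}\int_{B\cap\sigma}\rho_\sigma\,d\mathcal H^{d_\sigma}$ for all Borel $B\subseteq\mathbb R^d$. It is regular if (i) $d_\sigma\ge 2$ for every $\sigma\in\Sigma$; (ii) every $\rho_\sigma:\sigma\to\mathbb R$ is continuous with $\min_\sigma\rho_\sigma>0$; (iii) $K\setminus F$ is connected (in particular non-empty) for every finite $F\subseteq K$. Points $y_1,\dots,y_N\in\mathbb R^d$ are generic with respect to $\Sigma$ if for every $\sigma=[x_0,\dots,x_k]\in\Sigma$, all $p\in\{1,\dots,k\}$,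 $\ell\in\{1,\dots,\min(d,N-1)\}$, all distinct $i_0,\dots,i_\ell\in\{1,\dots,N\}$ and all distinct $j_0,\dots,j_p\in\{0,\dots,k\}$, $$\dim\bigl(\{y_{i_1}-y_{i_0},\dots,y_{i_\ell}-y_{i_0}\}^\perp\cap\mathrm{span}(x_{j_1}-x_{j_0},\dots,x_{j_p}-x_{j_0})\bigr)=\max(p-\ell,0).$$ For $\psi\in\mathbb R^N$ let $\mathrm{Lag}_i(\psi)=\{x\in K:\ \|x-y_i\|^2+\psi_i\le\|x-y_j\|^2+\psi_j\ \text{for all } j\}$, $\mathrm{Lag}_{i,j}(\psi)=\mathrm{Lag}_i(\psi)\cap\mathrm{Lag}_j(\psi)$, and $G(\psi)=(\mu(\mathrm{Lag}_i(\psi)))_{1\le i\le N}$. Theorem. Let $\mu$ be a regular simplicial measure on a simplex soup $\Sigma$ with densities $(\rho_\sigma)_{\sigma\in\Sigma}$ and let $y_1,\dots,y_N$ be generic with respect to $\Sigma$. Then $\mu$ is finite, $G:\mathbb R^N\to\mathbb R^N$ is of class $C^1$ on all of $\mathbb R^N$, and for every $\psi\in\mathbb R^N$ $$\frac{\partial G_i}{\partial\psi_j}(\psi)=\sum_{\sigma\in\Sigma}\frac{1}{2\,\|\Pi_{\sigma^0}(y_i-y_j)\|}\int_{\mathrm{Lag}_{i,j}(\psi)\cap\sigma}\rho_\sigma\,d\mathcal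 H^{d_\sigma-1}\qquad(i\ne j),$$ where the projections $\Pi_{\sigma^0}(y_i-y_j)$ are non-zero and the integrals converge, and $$\frac{\partial G_i}{\partial\psi_i}(\psi)=-\sum_{j\ne i}\frac{\partial G_i}{\partial\psi_j}(\psi)\qquad\text{for every } i.$$ -/

import Mathlib

open MeasureTheory Set

noncomputable section

namespace SemiDiscrete

/-- The Euclidean space `ℝ^d`. -/
abbrev Space (d : ℕ) : Type := EuclideanSpace ℝ (Fin d)

/-- A simplex soup: a family of nondegenerate simplices of `ℝ^d`, of possibly different dimensions,
indexed by `ι` (a finite type wherever it is used). -/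
structure SimplexSoup (ι : Type*) (d : ℕ) where
  /-- The dimension of each simplex. -/
  dim : ι → ℕ
  /-- The simplices, given by affinely independent vertices. -/
  simplex : ∀ a : ι, Affine.Simplex ℝ (Space d) (dim a)

namespace SimplexSoup

variable {ι : Type*} {d : ℕ}

/-- The simplex with index `a` as a set: the convex hull of its vertices. -/
def body (S : SimplexSoup ι d) (a : ι) : Set (Space d) :=
  convexHull ℝ (range (S.simplex a).points)

/-- The support of the soup: the union of its simplices. -/
def support (S : SimplexSoup ι d) : Set (Space d) := ⋃ a, S.body a

/-- The linear space tangent to the simplex with index `a`. -/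
def tangent (S : SimplexSoup ι d) (a : ι) : Submodule ℝ (Space d) :=
  vectorSpan ℝ (range (S.simplex a).points)

end SimplexSoup

/-- `μ` is the simplicial measure on the soup `S` with densities `ρ a` with respect to the
`dim a`-dimensional Hausdorff measure on the simplex `a`. Here `μHE[k]` is the `k`-dimensional
Hausdorff measure, normalized to agree with Lebesgue measure on `ℝ^k`.
The values of `ρ a` outside the simplex `a` play no role. -/
structure IsSimplicialMeasure {ι : Type*} [Fintype ι] {d : ℕ} (S : SimplexSoup ι d)
    (ρ : ι → Space d → ℝ) (μ : Measure (Space d)) : Prop where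
  density_measurable : ∀ a, AEMeasurable (ρ a) ((μHE[S.dim a]).restrict (S.body a))
  density_nonneg : ∀ a, ∀ x ∈ S.body a, 0 ≤ ρ a x
  apply_eq : ∀ B : Set (Space d), MeasurableSet B →
    μ B = ∑ a, ∫⁻ x in B ∩ S.body a, ENNReal.ofReal (ρ a x) ∂μHE[S.dim a]

/-- Regular simplicial measures. -/
structure IsRegularSimplicialMeasure {ι : Type*} [Fintype ι] {d : ℕ} (S : SimplexSoup ι d)
    (ρ : ι → Space d → ℝ) (μ : Measure (Space d)) : Prop
    extends IsSimplicialMeasure S ρ μ where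
  two_le_dim : ∀ a, 2 ≤ S.dim a
  density_continuous : ∀ a, ContinuousOn (ρ a) (S.body a)
  /-- The minimum of `ρ a` over the simplex is positive. -/
  density_min_pos : ∀ a, ∃ m : ℝ, IsLeast (ρ a '' S.body a) m ∧ 0 < m
  connected_diff : ∀ F : Set (Space d), F.Finite → F ⊆ S.support → IsConnected (S.support \ F)

/-- The points `y` are in generic position with respect to the `k`-dimensional simplex with
vertices `x 0, …, x k`. The subtraction `p - ℓ` is truncated, i.e. it is `max (p - ℓ) 0`. -/
def IsGenericSimplex {d N k : ℕ} (y : Fin N → Space d) (x : Fin (k + 1) → Space d) : Prop :=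
  ∀ p : ℕ, 1 ≤ p → p ≤ k → ∀ ℓ : ℕ, 1 ≤ ℓ → ℓ ≤ min d (N - 1) →
    ∀ (i : Fin (ℓ + 1) ↪ Fin N) (j : Fin (p + 1) ↪ Fin (k + 1)),
      Module.finrank ℝ
        ((Submodule.span ℝ (range fun m : Fin ℓ => y (i m.succ) - y (i 0)))ᗮ ⊓
          Submodule.span ℝ (range fun m : Fin p => x (j m.succ) - x (j 0)) :
          Submodule ℝ (Space d)) = p - ℓ

/-- The points `y` are in generic position with respect to the simplex soup `S`. -/
def IsGeneric {ι : Type*} {d N : ℕ} (y : Fin N → Space d) (S : SimplexSoup ι d) : Prop :=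
  ∀ a, IsGenericSimplex y (S.simplex a).points

/-- The power cell of `y i` for the weights `ψ`. -/
def powerCell {d N : ℕ} (y : Fin N → Space d) (ψ : Fin N → ℝ) (i : Fin N) : Set (Space d) :=
  {x | ∀ j, ‖x - y i‖ ^ 2 + ψ i ≤ ‖x - y j‖ ^ 2 + ψ j}

/-- The Laguerre cell `Lag_i(ψ)`: the part of the power cell inside the support of the soup. -/
def lag {ι : Type*} {d N : ℕ} (S : SimplexSoup ι d) (y : Fin N → Space d) (ψ : Fin N → ℝ)
    (i : Fin N) : Set (Space d) :=
  powerCell y ψ i ∩ S.support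

/-- The interface `Lag_{i,j}(ψ)` between two Laguerre cells. -/
def lagInter {ι : Type*} {d N : ℕ} (S : SimplexSoup ι d) (y : Fin N → Space d) (ψ : Fin N → ℝ)
    (i j : Fin N) : Set (Space d) :=
  lag S y ψ i ∩ lag S y ψ j

/-- The map `G(ψ) = (μ(Lag_i(ψ)))_i`. -/
def massMap {ι : Type*} {d N : ℕ} (S : SimplexSoup ι d) (μ : Measure (Space d))
    (y : Fin N → Space d) (ψ : Fin N → ℝ) : Fin N → ℝ :=
  fun i => (μ (lag S y ψ i)).toReal

/-- The sum over the simplices `σ` of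
`1 / (2 ‖Π_{σ⁰}(y_i - y_j)‖) * ∫_{Lag_{i,j}(ψ) ∩ σ} ρ_σ dH^{d_σ - 1}`. -/
def interfaceMass {ι : Type*} [Fintype ι] {d N : ℕ} (S : SimplexSoup ι d) (ρ : ι → Space d → ℝ)
    (y : Fin N → Space d) (ψ : Fin N → ℝ) (i j : Fin N) : ℝ :=
  ∑ a, 1 / (2 * ‖(S.tangent a).starProjection (y i - y j)‖) *
    ∫ x in lagInter S y ψ i j ∩ S.body a, ρ a x ∂μHE[S.dim a - 1]

end SemiDiscrete

end

/-! The measure is a finite sum over simplices, so it suffices to treat one simplex. There the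
quadratic terms of `‖x - y i‖ ^ 2 + ψ i ≤ ‖x - y j‖ ^ 2 + ψ j` cancel: in an isometric chart of the
affine span, the power cell inside the simplex is an intersection of half-spaces. Its normals are
fixed. The facet thresholds are fixed too, and the bisector thresholds are affine in `ψ`.

When one half-space moves, Fubini along its normal and the fundamental theorem of calculus give the
derivative as the integral over the moving face divided by the norm of the normal
(`hasDerivAt_integral_halfSpaces`). The face integral is continuous in the thresholds
(`continuous_faceIntegral`), by dominated convergence: no other bounding hyperplane contains the
slice, so each one cuts it in a null set. Continuous partial derivatives then yield `C¹`.

Genericity supplies this transversality (`cellNormal_notMem_span`). Two bisectors of the same cell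
are not parallel inside the simplex, and no bisector is parallel to a facet; both facts need
dimension at least 2. The bisector normal is twice the projection of `y j - y i` to the tangent
space, which explains the factor `1 / (2 * ‖Π(y i - y j)‖)`. The weight `ψ i` shifts all bisector
thresholds of cell `i` at rate `-1`, which gives the diagonal formula. -/

noncomputable section

namespace SemiDiscrete

open Filter Topology Asymptotics
open scoped RealInnerProductSpace

/-! ### Continuous partial derivatives imply `C¹` -/

section PartialDerivatives

variable {J : Type*} [Fintype J] [DecidableEq J]

/-- A function on a finite power of `ℝ` whose partial derivatives exist and are continuous is
differentiable. -/
theorem hasFDerivAt_of_continuous_partial {f : (J → ℝ) → ℝ} {f' : J → (J → ℝ) → ℝ}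
    (hf : ∀ x j, HasDerivAt (fun t => f (Function.update x j t)) (f' j x) (x j))
    (hc : ∀ j, Continuous (f' j)) (x₀ : J → ℝ) :
    HasFDerivAt f (∑ j, f' j x₀ • ContinuousLinearMap.proj (R := ℝ) (φ := fun _ : J => ℝ) j)
      x₀ := by
  have hpw : ∀ s : Finset J, Continuous fun x : J → ℝ => s.piecewise x x₀ := fun s =>
    continuous_pi fun i => by
      by_cases hi : i ∈ s <;> simp [hi] <;> fun_prop
  -- Coordinates are moved from `x₀` to `x` one at a time: only those in `s` have moved, and the
  -- induction adds one more.
  have key : ∀ s : Finset J,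
      (fun x : J → ℝ => f (s.piecewise x x₀) - f x₀ - ∑ j ∈ s, f' j x₀ * (x j - x₀ j))
        =o[𝓝 x₀] fun x => x - x₀ := by
    intro s
    induction s using Finset.induction_on with
    | empty => simp
    | insert j s hj ih =>
      have hu : Continuous fun p : (J → ℝ) × ℝ =>
          Function.update (s.piecewise p.1 x₀) j p.2 :=
        ((hpw s).comp continuous_fst).update j continuous_snd
      have h1 : (fun x : J → ℝ => f (Function.update (s.piecewise x x₀) j (x j)) -
          f (Function.update (s.piecewise x x₀) j (x₀ j)) - f' j x₀ * (x j - x₀ j))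
            =o[𝓝 x₀] fun x => x j - x₀ j := by
        rw [isLittleO_iff]
        intro ε hε
        have hcont : ContinuousAt (fun p : (J → ℝ) × ℝ =>
            f' j (Function.update (s.piecewise p.1 x₀) j p.2)) (x₀, x₀ j) :=
          ((hc j).comp hu).continuousAt
        obtain ⟨δ, hδ, h⟩ := Metric.continuousAt_iff.1 hcont ε hε
        filter_upwards [Metric.ball_mem_nhds x₀ hδ] with x hx
        have hxj : dist (x j) (x₀ j) < δ := (dist_le_pi_dist x x₀ j).trans_lt hx
        -- Mean value inequality for the function minus its linear part at `x₀`, whose derivative is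
        -- at most `ε` on the segment.
        refine le_of_eq_of_le (congrArg norm ?_) (Convex.norm_image_sub_le_of_norm_hasDerivWithin_le
          (f := fun y => f (Function.update (s.piecewise x x₀) j y) - f' j x₀ * y)
          (f' := fun y => f' j (Function.update (s.piecewise x x₀) j y) - f' j x₀)
          (s := segment ℝ (x₀ j) (x j)) (C := ε) (fun y _ => ?_) (fun y hy => ?_)
          (convex_segment _ _) (left_mem_segment ..) (right_mem_segment ..))
        · ring
        · have := hf (Function.update (s.piecewise x x₀) j y) j
          simp only [Function.update_idem, Function.update_self] at this
          have h3 := (this.sub ((hasDerivAt_id y).const_mul (f' j x₀))).hasDerivWithinAt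
            (s := segment ℝ (x₀ j) (x j))
          rw [mul_one] at h3
          exact h3
        · have hy' : dist y (x₀ j) < δ := by
            have := dist_add_dist_of_mem_segment hy
            rw [dist_comm (x₀ j) y, dist_comm (x₀ j) (x j)] at this
            linarith [dist_nonneg (x := y) (y := x j)]
          have := h (x := (x, y)) (by rw [Prod.dist_eq]; exact max_lt hx hy')
          have e0 : Function.update (s.piecewise x₀ x₀) j (x₀ j) = x₀ := by
            rw [Finset.piecewise_same, Function.update_eq_self]
          simp only [e0, dist_eq_norm] at this
          exact this.le
      have h2 : (fun x : J → ℝ => x j - x₀ j) =O[𝓝 x₀] fun x => x - x₀ :=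
        isBigO_of_le _ fun x => norm_le_pi_norm (x - x₀) j
      refine ((h1.trans_isBigO h2).add ih).congr_left fun x => ?_
      have e1 : Function.update (s.piecewise x x₀) j (x j) = (insert j s).piecewise x x₀ :=
        (Finset.piecewise_insert ..).symm
      have e2 : Function.update (s.piecewise x x₀) j (x₀ j) = s.piecewise x x₀ := by
        rw [Function.update_eq_self_iff]; simp [hj]
      simp only [e1, e2, Finset.sum_insert hj]
      ring
  rw [hasFDerivAt_iff_isLittleO]
  refine (key Finset.univ).congr_left fun x => ?_
  simp

/-- A function on a finite power of `ℝ` whose partial derivatives exist and are continuous is of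
class `C¹`. -/
theorem contDiff_one_of_continuous_partial {f : (J → ℝ) → ℝ} {f' : J → (J → ℝ) → ℝ}
    (hf : ∀ x j, HasDerivAt (fun t => f (Function.update x j t)) (f' j x) (x j))
    (hc : ∀ j, Continuous (f' j)) : ContDiff ℝ 1 f :=
  contDiff_one_iff_hasFDerivAt.2 ⟨_, by fun_prop, hasFDerivAt_of_continuous_partial hf hc⟩

end PartialDerivatives

/-! ### Fubini along a direction -/

section Slicing

variable {V : Type*} [NormedAddCommGroup V] [InnerProductSpace ℝ V] [FiniteDimensional ℝ V]
  [MeasurableSpace V] [BorelSpace V]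

/-- The level sets of a nonzero linear form are Lebesgue null. -/
theorem volume_setOf_linearMap_eq {L : V →ₗ[ℝ] ℝ} (hL : L ≠ 0) (c : ℝ) :
    volume {z | L z = c} = 0 := by
  rcases eq_empty_or_nonempty {z | L z = c} with h | ⟨z₀, hz₀⟩
  · simp [h]
  · have : {z | L z = c} = (AffineSubspace.mk' z₀ (LinearMap.ker L) : Set V) := by
      ext z
      simp only [mem_ofPred_eq] at hz₀
      simp [AffineSubspace.mem_mk', sub_eq_zero, hz₀]
    rw [this]
    refine Measure.addHaar_affineSubspace _ _ fun h => hL ?_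
    have := congrArg AffineSubspace.direction h
    rw [AffineSubspace.direction_mk', AffineSubspace.direction_top] at this
    exact LinearMap.ker_eq_top.1 this

/-- The point at height `r` over the point `z` of the hyperplane orthogonal to `n`. -/
def slicePoint (n : V) (r : ℝ) (z : (ℝ ∙ n)ᗮ) : V := r • n + z

omit [FiniteDimensional ℝ V] [MeasurableSpace V] [BorelSpace V] in
theorem continuous_slicePoint (n : V) :
    Continuous fun p : ℝ × (ℝ ∙ n)ᗮ => slicePoint n p.1 p.2 := by
  unfold slicePoint; fun_prop

omit [FiniteDimensional ℝ V] [MeasurableSpace V] [BorelSpace V] in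
theorem inner_slicePoint_self (n : V) (r : ℝ) (z : (ℝ ∙ n)ᗮ) :
    ⟪n, slicePoint n r z⟫ = r * ‖n‖ ^ 2 := by
  have h : ⟪n, (z : V)⟫ = 0 := z.2 n (Submodule.mem_span_singleton_self n)
  rw [slicePoint, inner_add_right, inner_smul_right, h, real_inner_self_eq_norm_sq, add_zero]

-- Pythagoras. It confines `z` to a ball independent of the height when the slice point stays in a
-- compact set.
omit [FiniteDimensional ℝ V] [MeasurableSpace V] [BorelSpace V] in
theorem norm_le_norm_slicePoint (n : V) (r : ℝ) (z : (ℝ ∙ n)ᗮ) : ‖z‖ ≤ ‖slicePoint n r z‖ := by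
  have h : ⟪r • n, (z : V)⟫ = 0 := by
    rw [inner_smul_left, z.2 n (Submodule.mem_span_singleton_self n), mul_zero]
  have := norm_add_sq_eq_norm_sq_add_norm_sq_real h
  rw [Submodule.coe_norm, slicePoint]
  refine le_of_sq_le_sq ?_ (norm_nonneg _)
  nlinarith [norm_nonneg (r • n)]

/-- The space is the orthogonal product of the line through `n` and its complement, and `r ↦ r • n`
stretches length by `‖n‖`. -/
theorem measurePreserving_slicePoint {n : V} (hn : n ≠ 0) :
    MeasurePreserving (fun p : ℝ × (ℝ ∙ n)ᗮ => slicePoint n p.1 p.2)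
      ((‖n‖ₑ • (volume : Measure ℝ)).prod volume) volume := by
  have h1 : MeasurePreserving (ContinuousLinearEquiv.toSpanNonzeroSingleton ℝ n hn)
      (‖n‖ₑ • (volume : Measure ℝ)) volume := by
    refine ⟨by fun_prop, ?_⟩
    let v' : (ℝ ∙ n) := ⟨n, Submodule.mem_span_singleton_self n⟩
    have := volume_eq_of_finrank_eq_one (finrank_span_singleton (K := ℝ) hn) (v := v')
      (by simpa [v'] using hn)
    rw [this, Measure.map_smul]
    rfl
  have h2 := ((ℝ ∙ n).measurePreserving_measurableEquivProd (0 : V)).symm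
  rw [InnerProductSpace.euclideanHausdorffMeasure_eq_volume] at h2
  have h3 := h2.comp (h1.prod (MeasurePreserving.id (volume : Measure (ℝ ∙ n)ᗮ)))
  convert! h3 using 1
  ext p
  simp [slicePoint]

theorem measurableEmbedding_slicePoint {n : V} (hn : n ≠ 0) :
    MeasurableEmbedding fun p : ℝ × (ℝ ∙ n)ᗮ => slicePoint n p.1 p.2 := by
  refine (continuous_slicePoint n).measurable.measurableEmbedding fun p q h => ?_
  have h1 := congrArg (fun v => ⟪n, v⟫) h
  simp only [inner_slicePoint_self] at h1
  have h2 : p.1 = q.1 := mul_right_cancel₀ (by positivity) h1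
  refine Prod.ext h2 (Subtype.ext ?_)
  simpa [slicePoint, h2] using h

/-- Fubini's theorem along the direction `n`. -/
theorem integral_eq_slicePoint {n : V} (hn : n ≠ 0) {f : V → ℝ} (hf : Integrable f) :
    Integrable (fun r => ∫ z, f (slicePoint n r z)) ∧
      ∫ v, f v = ‖n‖ * ∫ r, ∫ z, f (slicePoint n r z) := by
  have hmp := measurePreserving_slicePoint hn
  have hint := (hmp.integrable_comp_emb (measurableEmbedding_slicePoint hn)).2 hf
  rw [← hmp.integral_comp (measurableEmbedding_slicePoint hn)]
  have hfin : ‖n‖ₑ ≠ ⊤ := enorm_ne_top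
  have hz : ‖n‖ₑ ≠ 0 := by simpa using hn
  have : SFinite (‖n‖ₑ • (volume : Measure ℝ)) := by
    infer_instance
  rw [integral_prod (fun p : ℝ × (ℝ ∙ n)ᗮ => f (slicePoint n p.1 p.2)) hint,
    integral_smul_measure]
  refine ⟨?_, by simp⟩
  exact (integrable_smul_measure hz hfin).1 hint.integral_prod_left

end Slicing

/-! ### Moving one half-space of an intersection -/

section HalfSpaces

variable {V : Type*} [NormedAddCommGroup V] [InnerProductSpace ℝ V]
variable {I : Type*}

/-- The intersection of the half-spaces `⟪n l, v⟫ ≤ t l`. -/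
def halfSpaces (n : I → V) (t : I → ℝ) : Set V := {v | ∀ l, ⟪n l, v⟫ ≤ t l}

/-- The slice of `halfSpaces n t` by the hyperplane `⟪n j, v⟫ = t j`, in coordinates of the
orthogonal complement of `n j`. -/
def faceSlice (n : I → V) (t : I → ℝ) (j : I) : Set (ℝ ∙ n j)ᗮ :=
  {z | ∀ l, l ≠ j → ⟪n l, slicePoint (n j) (t j / ‖n j‖ ^ 2) z⟫ ≤ t l}

/-- The integral of `g` over the face of `halfSpaces n t` with index `j`. -/
def faceIntegral [MeasurableSpace V] [BorelSpace V] [FiniteDimensional ℝ V] (n : I → V) (g : V → ℝ)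
    (j : I) (t : I → ℝ) : ℝ :=
  ∫ z in faceSlice n t j, g (slicePoint (n j) (t j / ‖n j‖ ^ 2) z)

theorem isClosed_halfSpaces (n : I → V) (t : I → ℝ) : IsClosed (halfSpaces n t) := by
  simp only [halfSpaces, ofPred_forall]
  exact isClosed_iInter fun l => isClosed_le (by fun_prop) (by fun_prop)

theorem isClosed_faceSlice (n : I → V) (t : I → ℝ) (j : I) : IsClosed (faceSlice n t j) := by
  simp only [faceSlice, ofPred_forall]
  refine isClosed_iInter fun l => isClosed_iInter fun _ => isClosed_le ?_ (by fun_prop)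
  unfold slicePoint
  fun_prop

variable [FiniteDimensional ℝ V] [MeasurableSpace V] [BorelSpace V]

-- The bound is uniform in `r`, so it can dominate the slice integrals for all thresholds at once.
omit [FiniteDimensional ℝ V] [MeasurableSpace V] [BorelSpace V] in
theorem exists_bound_slicePoint {g : V → ℝ} (hg : Continuous g) (hs : HasCompactSupport g) :
    ∃ R C : ℝ, ∀ (n : V) (r : ℝ) (z : (ℝ ∙ n)ᗮ),
      ‖g (slicePoint n r z)‖ ≤ (Metric.closedBall 0 R).indicator (fun _ => C) z := by
  obtain ⟨C, hC⟩ := hs.exists_bound_of_continuous hg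
  obtain ⟨R, hR⟩ := hs.isCompact.isBounded.subset_closedBall 0
  refine ⟨R, C, fun n r z => ?_⟩
  by_cases hz : z ∈ Metric.closedBall 0 R
  · rw [indicator_of_mem hz]
    exact hC _
  · rw [indicator_of_notMem hz, norm_le_zero_iff]
    refine image_eq_zero_of_notMem_tsupport fun h => hz ?_
    have := hR h
    rw [mem_closedBall_zero_iff] at this ⊢
    exact (norm_le_norm_slicePoint n r z).trans this

theorem integrable_slicePoint {g : V → ℝ} (hg : Continuous g) (hs : HasCompactSupport g)
    (n : V) (r : ℝ) : Integrable fun z : (ℝ ∙ n)ᗮ => g (slicePoint n r z) := by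
  obtain ⟨R, C, h⟩ := exists_bound_slicePoint hg hs
  have hc : Continuous fun z : (ℝ ∙ n)ᗮ => g (slicePoint n r z) := by
    unfold slicePoint; fun_prop
  refine Integrable.mono' ?_ hc.aestronglyMeasurable (Eventually.of_forall (h n r))
  exact (integrable_indicator_iff measurableSet_closedBall).2
    (integrableOn_const (isCompact_closedBall _ _).measure_ne_top)

variable [Fintype I]

/-- The face integrals depend continuously on the thresholds, provided that the hyperplanes are
pairwise transverse. -/
theorem continuous_faceIntegral {n : I → V} {g : V → ℝ} (hg : Continuous g)
    (hs : HasCompactSupport g) (j : I) (hn : ∀ l, l ≠ j → n l ∉ (ℝ ∙ n j)) :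
    Continuous (faceIntegral n g j) := by
  obtain ⟨R, C, hb⟩ := exists_bound_slicePoint hg hs
  have hpt : Continuous fun p : (I → ℝ) × (ℝ ∙ n j)ᗮ =>
      slicePoint (n j) (p.1 j / ‖n j‖ ^ 2) p.2 := by
    unfold slicePoint; fun_prop
  have hpt' : ∀ z : (ℝ ∙ n j)ᗮ, Continuous fun t : I → ℝ =>
      slicePoint (n j) (t j / ‖n j‖ ^ 2) z := fun z => by
    unfold slicePoint; fun_prop
  refine continuous_iff_continuousAt.2 fun t₀ => ?_
  have heq : faceIntegral n g j = fun t => ∫ z : (ℝ ∙ n j)ᗮ, (faceSlice n t j).indicator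
      (fun z => g (slicePoint (n j) (t j / ‖n j‖ ^ 2) z)) z := by
    ext t
    rw [integral_indicator (isClosed_faceSlice n t j).measurableSet, faceIntegral]
  rw [heq]
  refine continuousAt_of_dominated (bound := (Metric.closedBall 0 R).indicator fun _ => C)
    (Eventually.of_forall fun t => ?_) (Eventually.of_forall fun t => Eventually.of_forall fun z =>
      (norm_indicator_le_norm_self _ _).trans (hb _ _ _)) ?_ ?_
  · exact ((integrable_slicePoint hg hs _ _).indicator
      (isClosed_faceSlice n t j).measurableSet).aestronglyMeasurable
  · exact (integrable_indicator_iff measurableSet_closedBall).2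
      (integrableOn_const (isCompact_closedBall _ _).measure_ne_top)
  -- Since `n l` is not a multiple of `n j`, it restricts to a nonzero form on the orthogonal
  -- complement, whose level sets are null.
  · have hae : ∀ᵐ z : (ℝ ∙ n j)ᗮ, ∀ l, l ≠ j →
        ⟪n l, slicePoint (n j) (t₀ j / ‖n j‖ ^ 2) z⟫ ≠ t₀ l := by
      refine ae_all_iff.2 fun l => ?_
      by_cases hl : l = j
      · exact Eventually.of_forall fun z h => absurd hl h
      let L : (ℝ ∙ n j)ᗮ →ₗ[ℝ] ℝ := (innerₗ V (n l)).comp (ℝ ∙ n j)ᗮ.subtype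
      have hL : L ≠ 0 := fun h => hn l hl <| by
        rw [← Submodule.orthogonal_orthogonal (ℝ ∙ n j), Submodule.mem_orthogonal']
        exact fun u hu => LinearMap.congr_fun h ⟨u, hu⟩
      have := volume_setOf_linearMap_eq hL (t₀ l - ⟪n l, (t₀ j / ‖n j‖ ^ 2) • n j⟫)
      refine measure_mono_null (fun z hz => ?_) this
      simp only [mem_compl_iff, mem_ofPred_eq, not_forall, not_not] at hz
      obtain ⟨-, hz⟩ := hz
      rw [slicePoint, inner_add_right] at hz
      change ⟪n l, (z : V)⟫ = _
      linarith
    filter_upwards [hae] with z hz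
    have hcl : ∀ l, Continuous fun t : I → ℝ =>
        ⟪n l, slicePoint (n j) (t j / ‖n j‖ ^ 2) z⟫ := fun l => by
      have := hpt' z
      fun_prop
    -- Off this null set every constraint is strict or strictly violated. Both are open conditions
    -- in `t`, so the indicator is locally constant at `t₀`.
    by_cases hmem : z ∈ faceSlice n t₀ j
    · have hev : ∀ᶠ t in 𝓝 t₀, z ∈ faceSlice n t j := by
        have : ∀ᶠ t in 𝓝 t₀, ∀ l, l ≠ j →
            ⟪n l, slicePoint (n j) (t j / ‖n j‖ ^ 2) z⟫ < t l := by
          refine eventually_all.2 fun l => ?_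
          by_cases hl : l = j
          · exact Eventually.of_forall fun z h => absurd hl h
          filter_upwards [(hcl l).continuousAt.eventually_lt (continuous_apply l).continuousAt
            (lt_of_le_of_ne (hmem l hl) (hz l hl))] with t ht _ using ht
        filter_upwards [this] with t ht l hl using (ht l hl).le
      refine ContinuousAt.congr (f := fun t => g (slicePoint (n j) (t j / ‖n j‖ ^ 2) z))
        (hg.continuousAt.comp (hpt' z).continuousAt) ?_
      filter_upwards [hev] with t ht
      rw [indicator_of_mem ht]
    · have hmem' := hmem
      simp only [faceSlice, mem_ofPred_eq, not_forall, not_le] at hmem'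
      obtain ⟨l, hl, hlt⟩ := hmem'
      have hev : ∀ᶠ t in 𝓝 t₀, z ∉ faceSlice n t j := by
        filter_upwards [(continuous_apply l).continuousAt.eventually_lt (hcl l).continuousAt hlt]
          with t ht h using absurd (h l hl) (not_le.2 ht)
      refine ContinuousAt.congr (f := fun _ => (0 : ℝ)) continuousAt_const ?_
      filter_upwards [hev] with t ht
      rw [indicator_of_notMem ht]

variable [DecidableEq I]

/-- The derivative of the integral over an intersection of half-spaces when one of them moves. -/
theorem hasDerivAt_integral_halfSpaces {n : I → V} {g : V → ℝ} (hg : Continuous g)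
    (hs : HasCompactSupport g) (j : I) (hj : n j ≠ 0) (hn : ∀ l, l ≠ j → n l ∉ (ℝ ∙ n j))
    (t : I → ℝ) :
    HasDerivAt (fun s => ∫ v in halfSpaces n (Function.update t j s), g v)
      (1 / ‖n j‖ * faceIntegral n g j t) (t j) := by
  have hpos : 0 < ‖n j‖ := norm_pos_iff.2 hj
  have hne : ‖n j‖ ^ 2 ≠ 0 := by positivity
  -- `h r` is the integral over the slice at height `r`, where `⟪n j, v⟫ = r * ‖n j‖ ^ 2`. The
  -- constraint at threshold `s` thus reads `r ≤ s / ‖n j‖ ^ 2`.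
  set h : ℝ → ℝ := fun r => faceIntegral n g j (Function.update t j (r * ‖n j‖ ^ 2)) with hh
  have hhc : Continuous h := (continuous_faceIntegral hg hs j hn).comp
    ((continuous_const (y := t)).update j (by fun_prop))
  have hint : Integrable g := hg.integrable_of_hasCompactSupport hs
  have hF : ∀ s, IntegrableOn h (Iic (s / ‖n j‖ ^ 2)) ∧
      ∫ v in halfSpaces n (Function.update t j s), g v
        = ‖n j‖ * ∫ r in Iic (s / ‖n j‖ ^ 2), h r := by
    intro s
    have hm := (isClosed_halfSpaces n (Function.update t j s)).measurableSet
    obtain ⟨h1, h2⟩ := integral_eq_slicePoint hj (hint.indicator hm)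
    have hin : (fun r => ∫ z : (ℝ ∙ n j)ᗮ, (halfSpaces n (Function.update t j s)).indicator g
        (slicePoint (n j) r z)) = (Iic (s / ‖n j‖ ^ 2)).indicator h := by
      ext r
      by_cases hr : r ∈ Iic (s / ‖n j‖ ^ 2)
      · rw [indicator_of_mem hr, hh]
        simp only [faceIntegral]
        rw [← integral_indicator (isClosed_faceSlice _ _ j).measurableSet]
        congr 1 with z
        simp only [Function.update_self, mul_div_cancel_right₀ _ hne]
        have hiff : slicePoint (n j) r z ∈ halfSpaces n (Function.update t j s) ↔
            z ∈ faceSlice n (Function.update t j (r * ‖n j‖ ^ 2)) j := by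
          simp only [halfSpaces, faceSlice, mem_ofPred_eq, Function.update_self,
            mul_div_cancel_right₀ _ hne]
          constructor
          · intro H l hl
            simpa [hl] using H l
          · intro H l
            by_cases hl : l = j
            · subst hl
              rw [inner_slicePoint_self, Function.update_self]
              exact (le_div_iff₀ (by positivity)).1 hr
            · simpa [hl] using H l hl
        by_cases hz : z ∈ faceSlice n (Function.update t j (r * ‖n j‖ ^ 2)) j
        · rw [indicator_of_mem (hiff.2 hz), indicator_of_mem hz]
        · rw [indicator_of_notMem (mt hiff.1 hz), indicator_of_notMem hz]
      · rw [indicator_of_notMem hr]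
        refine integral_eq_zero_of_ae (Eventually.of_forall fun z => indicator_of_notMem ?_ _)
        intro H
        have := H j
        rw [inner_slicePoint_self, Function.update_self] at this
        exact hr ((le_div_iff₀ (by positivity)).2 this)
    rw [integral_indicator hm] at h2
    rw [hin] at h1 h2
    exact ⟨(integrable_indicator_iff measurableSet_Iic).1 h1, by
      rw [h2, integral_indicator measurableSet_Iic]⟩
  -- The base point `0` is arbitrary. Differentiation brings out `1 / ‖n j‖ ^ 2`, which with the
  -- Fubini factor `‖n j‖` leaves `1 / ‖n j‖`.
  have hF' : (fun s => ∫ v in halfSpaces n (Function.update t j s), g v) = fun s =>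
      ‖n j‖ * ((∫ r in Iic (0 / ‖n j‖ ^ 2), h r) + ∫ r in (0 / ‖n j‖ ^ 2)..(s / ‖n j‖ ^ 2), h r) := by
    ext s
    rw [(hF s).2, ← intervalIntegral.integral_Iic_sub_Iic (hF 0).1 (hF s).1]
    ring
  rw [hF']
  have hd := (intervalIntegral.integral_hasDerivAt_right (hhc.intervalIntegrable
    (0 / ‖n j‖ ^ 2) (t j / ‖n j‖ ^ 2)) hhc.aestronglyMeasurable.stronglyMeasurableAtFilter
    hhc.continuousAt)
  have hd2 := ((hd.comp (t j) ((hasDerivAt_id (t j)).div_const (‖n j‖ ^ 2))).const_add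
    (∫ r in Iic (0 / ‖n j‖ ^ 2), h r)).const_mul ‖n j‖
  refine hd2.congr_deriv ?_
  have : h (t j / ‖n j‖ ^ 2) = faceIntegral n g j t := by
    simp only [hh]
    rw [div_mul_cancel₀ _ hne, Function.update_eq_self]
  simp only [this]
  field_simp

end HalfSpaces

/-! ### Transversality from genericity -/

section Generic

variable {d N k : ℕ}

theorem span_range_succ_sub_zero {E : Type*} [AddCommGroup E] [Module ℝ E] {n : ℕ}
    (p : Fin (n + 1) → E) :
    Submodule.span ℝ (range fun m : Fin n => p m.succ - p 0) = vectorSpan ℝ (range p) := by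
  rw [vectorSpan_range_eq_span_range_vsub_right ℝ p 0]
  refine le_antisymm (Submodule.span_mono ?_) (Submodule.span_le.2 ?_)
  · rintro _ ⟨m, rfl⟩
    exact ⟨m.succ, rfl⟩
  · rintro _ ⟨m, rfl⟩
    refine Fin.cases ?_ (fun m => ?_) m
    · simp
    · exact Submodule.subset_span ⟨m, rfl⟩

/-- The embedding `i` already forces `ℓ ≤ N - 1`, so only `ℓ ≤ d` remains to be checked. -/
theorem IsGenericSimplex.finrank_eq {y : Fin N → Space d} {x : Fin (k + 1) → Space d}
    (h : IsGenericSimplex y x) {p : ℕ} (hp : 1 ≤ p) (hpk : p ≤ k) {ℓ : ℕ} (hℓ : 1 ≤ ℓ)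
    (hℓd : ℓ ≤ d) (i : Fin (ℓ + 1) ↪ Fin N) (j : Fin (p + 1) ↪ Fin (k + 1)) :
    Module.finrank ℝ
      ((Submodule.span ℝ (range fun m : Fin ℓ => y (i m.succ) - y (i 0)))ᗮ ⊓
        vectorSpan ℝ (range (x ∘ j)) : Submodule ℝ (Space d)) = p - ℓ := by
  have hN : ℓ + 1 ≤ N := by simpa using Fintype.card_le_of_embedding i
  rw [← span_range_succ_sub_zero]
  exact h p hp hpk ℓ hℓ (le_min hℓd (by omega)) i j

theorem mem_orthogonal_span_range {E α : Type*} [NormedAddCommGroup E] [InnerProductSpace ℝ E]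
    (f : α → E) (v : E) : v ∈ (Submodule.span ℝ (range f))ᗮ ↔ ∀ m, ⟪f m, v⟫ = 0 := by
  rw [Submodule.mem_orthogonal]
  refine ⟨fun h m => h _ (Submodule.subset_span ⟨m, rfl⟩), fun h u hu => ?_⟩
  induction hu using Submodule.span_induction with
  | mem u hu => obtain ⟨m, rfl⟩ := hu; exact h m
  | zero => simp
  | add a b _ _ ha hb => rw [inner_add_left, ha, hb, add_zero]
  | smul c a _ ha => rw [inner_smul_left, ha, mul_zero]

variable {y : Fin N → Space d} (s : Affine.Simplex ℝ (Space d) k)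

theorem finrank_vectorSpan_simplex : Module.finrank ℝ (vectorSpan ℝ (range s.points)) = k :=
  s.independent.finrank_vectorSpan (by simp)

theorem dim_simplex_le (s : Affine.Simplex ℝ (Space d) k) : k ≤ d := by
  have := Submodule.finrank_le (vectorSpan ℝ (range s.points))
  rwa [finrank_vectorSpan_simplex, finrank_euclideanSpace_fin] at this

variable {s}

/-- On the simplex, the hyperplane between two sites meets each face of positive dimension
transversally. -/
theorem IsGenericSimplex.not_orthogonal_face (h : IsGenericSimplex y s.points) {p : ℕ}
    (hp : 1 ≤ p) (hpk : p ≤ k) (j : Fin (p + 1) ↪ Fin (k + 1)) {a b : Fin N} (hab : a ≠ b) :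
    ∃ v ∈ vectorSpan ℝ (range (s.points ∘ j)), ⟪y b - y a, v⟫ ≠ 0 := by
  by_contra! H
  have hd := dim_simplex_le s
  have h1 := h.finrank_eq hp hpk le_rfl (by omega)
    ⟨![a, b], by
      intro m n; fin_cases m <;> fin_cases n <;> simp [hab, hab.symm]⟩ j
  -- Orthogonality would make the intersection the whole `p`-dimensional face direction, whereas
  -- genericity with `ℓ = 1` gives `p - 1`.
  rw [inf_eq_right.2, (s.independent.comp_embedding j).finrank_vectorSpan (n := p) (by simp)] at h1
  · omega
  · intro v hv
    rw [mem_orthogonal_span_range]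
    intro m
    fin_cases m
    exact H v hv

/-- Inside the simplex, the hyperplanes between one site and two others are transverse. -/
theorem IsGenericSimplex.not_proportional (h : IsGenericSimplex y s.points) (hk : 2 ≤ k)
    {a b c : Fin N} (hab : a ≠ b) (hac : a ≠ c) (hbc : b ≠ c) (r : ℝ) :
    ∃ v ∈ vectorSpan ℝ (range s.points), ⟪y c - y a, v⟫ ≠ r * ⟪y b - y a, v⟫ := by
  by_contra! H
  have hd := dim_simplex_le s
  have h1 := h.finrank_eq (p := k) (by omega) le_rfl (ℓ := 1) le_rfl (by omega)
    ⟨![a, b], by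
      intro m n; fin_cases m <;> fin_cases n <;> simp [hab, hab.symm]⟩ (Function.Embedding.refl _)
  have h2 := h.finrank_eq (p := k) (by omega) le_rfl (ℓ := 2) (by omega) (by omega)
    ⟨![a, b, c], by
      intro m n
      fin_cases m <;> fin_cases n <;> simp [hab, hab.symm, hac, hac.symm, hbc, hbc.symm]⟩
    (Function.Embedding.refl _)
  -- Proportionality makes the second condition redundant, so `k - 1 = k - 2`. In truncated
  -- subtraction this is absurd because `2 ≤ k`.
  have h3 := h1.symm.trans ((congrArg (fun W : Submodule ℝ (Space d) => Module.finrank ℝ W)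
    (le_antisymm ?_ ?_)).trans h2)
  · omega
  · rintro v ⟨hv1, hv2⟩
    refine ⟨?_, hv2⟩
    have hv1 := (mem_orthogonal_span_range _ _).1 hv1 0
    change ⟪y b - y a, v⟫ = 0 at hv1
    refine (mem_orthogonal_span_range _ _).2 fun m => ?_
    fin_cases m
    · exact hv1
    · change ⟪y c - y a, v⟫ = 0
      rw [H v hv2, hv1, mul_zero]
  · rintro v ⟨hv1, hv2⟩
    refine ⟨?_, hv2⟩
    have hv1 := (mem_orthogonal_span_range _ _).1 hv1 0
    refine (mem_orthogonal_span_range _ _).2 fun m => ?_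
    fin_cases m
    exact hv1

end Generic

/-! ### Hausdorff measure in isometric charts -/

section Charts

variable {W X : Type*} [NormedAddCommGroup W] [InnerProductSpace ℝ W] [FiniteDimensional ℝ W]
  [MeasurableSpace W] [BorelSpace W] [MetricSpace X] [MeasurableSpace X] [BorelSpace X]

theorem map_volume_isometry {e : W → X} (he : Isometry e) {m : ℕ} (hm : Module.finrank ℝ W = m) :
    (volume : Measure W).map e = (μHE[m]).restrict (range e) := by
  rw [← InnerProductSpace.euclideanHausdorffMeasure_eq_volume, he.map_euclideanHausdorffMeasure, hm]

theorem restrict_image_isometry {e : W → X} (he : Isometry e) {m : ℕ}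
    (hm : Module.finrank ℝ W = m) (Z : Set W) :
    (μHE[m]).restrict (e '' Z) = ((volume : Measure W).map e).restrict (e '' Z) := by
  rw [map_volume_isometry he hm,
    Measure.restrict_restrict_of_subset (image_subset_range e Z)]

theorem setIntegral_image_isometry {e : W → X} (he : Isometry e) {m : ℕ}
    (hm : Module.finrank ℝ W = m) (f : X → ℝ) (Z : Set W) :
    ∫ x in e '' Z, f x ∂μHE[m] = ∫ z in Z, f (e z) := by
  rw [restrict_image_isometry he hm, he.isClosedEmbedding.measurableEmbedding.setIntegral_map,
    he.injective.preimage_image]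

theorem integrableOn_image_isometry {e : W → X} (he : Isometry e) {m : ℕ}
    (hm : Module.finrank ℝ W = m) (f : X → ℝ) (Z : Set W) :
    IntegrableOn f (e '' Z) μHE[m] ↔ IntegrableOn (f ∘ e) Z := by
  rw [IntegrableOn, restrict_image_isometry he hm, ← IntegrableOn,
    he.isClosedEmbedding.measurableEmbedding.integrableOn_map_iff, he.injective.preimage_image]

end Charts

/-- A continuous function on a compact set extends to a compactly supported one. -/
theorem exists_hasCompactSupport_eqOn {V : Type*} [MetricSpace V] [ProperSpace V] {K : Set V}
    (hK : IsCompact K) {f : V → ℝ} (hf : ContinuousOn f K) :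
    ∃ g : V → ℝ, Continuous g ∧ HasCompactSupport g ∧ EqOn g f K := by
  obtain ⟨g, hg⟩ := ContinuousMap.exists_restrict_eq hK.isClosed
    ⟨K.domRestrict f, continuousOn_iff_continuous_domRestrict.1 hf⟩
  obtain ⟨χ, h1, -, hs, -⟩ := exists_continuous_one_zero_of_isCompact hK isClosed_empty
    (disjoint_empty K)
  refine ⟨fun x => χ x * g x, by fun_prop, hs.mul_right, fun x hx => ?_⟩
  have := congrArg (fun F : C(K, ℝ) => F ⟨x, hx⟩) hg
  change g x = f x at this
  simp [h1 hx, this]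

/-! ### A simplex as an intersection of half-spaces -/

section Simplex

variable {d k : ℕ} (s : Affine.Simplex ℝ (Space d) k)

/-- The chart of the affine span of a simplex centred at its first vertex. -/
def chart (v : vectorSpan ℝ (range s.points)) : Space d := s.points 0 + v

theorem isometry_chart : Isometry (chart s) :=
  Isometry.of_dist_eq fun v w => by simp [chart, dist_eq_norm]

/-- The vertices of a simplex in the chart of its affine span. -/
def chartBasis : AffineBasis (Fin (k + 1)) ℝ (vectorSpan ℝ (range s.points)) where
  toFun m := ⟨s.points m - s.points 0, vsub_mem_vectorSpan ℝ ⟨m, rfl⟩ ⟨0, rfl⟩⟩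
  ind' := by
    refine AffineIndependent.of_comp (AffineMap.const ℝ _ (s.points 0) +
      (vectorSpan ℝ (range s.points)).subtype.toAffineMap) ?_
    convert! s.independent using 1
    ext m
    simp
  tot' := by
    refine (AffineIndependent.affineSpan_eq_top_iff_card_eq_finrank_add_one ?_).2 ?_
    · refine AffineIndependent.of_comp (AffineMap.const ℝ _ (s.points 0) +
        (vectorSpan ℝ (range s.points)).subtype.toAffineMap) ?_
      convert! s.independent using 1
      ext m
      simp
    · rw [finrank_vectorSpan_simplex, Fintype.card_fin]

theorem coe_chartBasis (m : Fin (k + 1)) : (chartBasis s m : Space d) = s.points m - s.points 0 :=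
  rfl

/-- The outward normals of the facets of a simplex. -/
def facetNormal (f : Fin (k + 1)) : vectorSpan ℝ (range s.points) :=
  -(InnerProductSpace.toDual ℝ _).symm
    (LinearMap.toContinuousLinearMap ((chartBasis s).coord f).linear)

/-- A barycentric coordinate is affine and the normal is minus its gradient, so nonnegativity of the
coordinate is a half-space condition with threshold its value at `0`. -/
theorem inner_facetNormal (f : Fin (k + 1)) (v : vectorSpan ℝ (range s.points)) :
    ⟪facetNormal s f, v⟫ = (chartBasis s).coord f 0 - (chartBasis s).coord f v := by
  rw [facetNormal, inner_neg_left, InnerProductSpace.toDual_symm_apply,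
    LinearMap.coe_toContinuousLinearMap', AffineMap.decomp' ((chartBasis s).coord f)]
  simp

theorem convexHull_eq_image_chart :
    convexHull ℝ (range s.points) =
      chart s '' halfSpaces (facetNormal s) fun f => (chartBasis s).coord f 0 := by
  have h1 : halfSpaces (facetNormal s) (fun f => (chartBasis s).coord f 0) =
      convexHull ℝ (range (chartBasis s)) := by
    rw [AffineBasis.convexHull_eq_nonneg_coord]
    ext v
    simp only [halfSpaces, inner_facetNormal, mem_ofPred_eq, sub_le_self_iff]
  have h2 : chart s = ⇑(AffineMap.const ℝ (vectorSpan ℝ (range s.points)) (s.points 0) +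
      (vectorSpan ℝ (range s.points)).subtype.toAffineMap) := by
    ext1 v
    simp [chart]
  rw [h1, h2, AffineMap.image_convexHull, ← h2, ← range_comp]
  congr 2
  ext1 m
  simp [chart, coe_chartBasis]

/-- The coordinate is `1` at vertex `f` and `0` at any other vertex, hence not constant. -/
theorem facetNormal_ne_zero (hk : 1 ≤ k) (f : Fin (k + 1)) : facetNormal s f ≠ 0 := by
  intro h
  have : Nontrivial (Fin (k + 1)) := Fin.nontrivial_iff_two_le.2 (by omega)
  obtain ⟨m, hm⟩ := exists_ne f
  have h1 := inner_facetNormal s f (chartBasis s m)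
  have h2 := inner_facetNormal s f (chartBasis s f)
  rw [h, inner_zero_left, AffineBasis.coord_apply] at h1 h2
  simp [hm.symm] at h1 h2
  linarith

/-- The normal of a facet is orthogonal to it. -/
theorem inner_facetNormal_eq_zero {k : ℕ} (s : Affine.Simplex ℝ (Space d) (k + 1))
    (f : Fin (k + 2)) {v : vectorSpan ℝ (range s.points)}
    (hv : (v : Space d) ∈ vectorSpan ℝ (range (s.points ∘ f.succAboveEmb))) :
    ⟪facetNormal s f, v⟫ = 0 := by
  -- The facet direction is spanned by differences of vertices other than `f`, and coordinate `f`
  -- vanishes at all of these.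
  have hle : vectorSpan ℝ (range (s.points ∘ f.succAboveEmb)) ≤
      (LinearMap.ker (innerₗ _ (facetNormal s f))).map
        (vectorSpan ℝ (range s.points)).subtype := by
    rw [vectorSpan_range_eq_span_range_vsub_right ℝ _ 0, Submodule.span_le]
    rintro _ ⟨m, rfl⟩
    refine ⟨chartBasis s (f.succAbove m) - chartBasis s (f.succAbove 0), ?_, ?_⟩
    · rw [SetLike.mem_coe, LinearMap.mem_ker, innerₗ_apply_apply, inner_sub_right,
        inner_facetNormal, inner_facetNormal, AffineBasis.coord_apply, AffineBasis.coord_apply,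
        if_neg (Fin.succAbove_ne f _).symm, if_neg (Fin.succAbove_ne f _).symm, sub_self]
    · simp [coe_chartBasis]
  obtain ⟨w, hw, hwv⟩ := hle hv
  rw [← Subtype.ext hwv]
  exact hw

end Simplex

/-! ### Faces as Hausdorff-measured sets -/

section Faces

variable {V : Type*} [NormedAddCommGroup V] [InnerProductSpace ℝ V] {I : Type*}

theorem isometry_slicePoint (n : V) (r : ℝ) : Isometry (slicePoint n r) :=
  Isometry.of_dist_eq fun z w => by simp [slicePoint, Subtype.dist_eq]

/-- The multiple of `n j` on its own hyperplane is `(t j / ‖n j‖ ^ 2) • n j`. This identifies the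
coordinates of `faceSlice` with the actual face. -/
theorem image_slicePoint_faceSlice {n : I → V} (t : I → ℝ) {j : I} (hj : n j ≠ 0) :
    slicePoint (n j) (t j / ‖n j‖ ^ 2) '' faceSlice n t j =
      {v | v ∈ halfSpaces n t ∧ ⟪n j, v⟫ = t j} := by
  have hne : ‖n j‖ ^ 2 ≠ 0 := by positivity
  ext v
  constructor
  · rintro ⟨z, hz, rfl⟩
    have h : ⟪n j, slicePoint (n j) (t j / ‖n j‖ ^ 2) z⟫ = t j := by
      rw [inner_slicePoint_self, div_mul_cancel₀ _ hne]
    refine ⟨fun l => ?_, h⟩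
    by_cases hl : l = j
    · subst hl; exact h.le
    · exact hz l hl
  · rintro ⟨hv, h⟩
    have hz : v - (t j / ‖n j‖ ^ 2) • n j ∈ (ℝ ∙ n j)ᗮ := by
      rw [Submodule.mem_orthogonal_singleton_iff_inner_right, inner_sub_right, inner_smul_right,
        real_inner_self_eq_norm_sq, h, div_mul_cancel₀ _ hne, sub_self]
    have hzv : slicePoint (n j) (t j / ‖n j‖ ^ 2) ⟨_, hz⟩ = v := by simp [slicePoint]
    refine ⟨⟨_, hz⟩, fun l _ => ?_, hzv⟩
    rw [hzv]
    exact hv l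

theorem finrank_orthogonal_singleton [FiniteDimensional ℝ V] {n : V} (hn : n ≠ 0) :
    Module.finrank ℝ (ℝ ∙ n)ᗮ = Module.finrank ℝ V - 1 := by
  have := (ℝ ∙ n).finrank_add_finrank_orthogonal
  rw [finrank_span_singleton hn] at this
  omega

variable {X : Type*} [MetricSpace X] [MeasurableSpace X] [BorelSpace X] [FiniteDimensional ℝ V]
  [MeasurableSpace V] [BorelSpace V]

/-- The integral over an isometric image of an intersection of half-spaces. -/
theorem setIntegral_image_halfSpaces {n : I → V} {t : I → ℝ} {e : V → X} (he : Isometry e) {k : ℕ}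
    (hk : Module.finrank ℝ V = k) {f : X → ℝ} {g : V → ℝ} (h : EqOn g (f ∘ e) (halfSpaces n t)) :
    ∫ x in e '' halfSpaces n t, f x ∂μHE[k] = ∫ v in halfSpaces n t, g v := by
  rw [setIntegral_image_isometry he hk]
  exact (setIntegral_congr_fun (isClosed_halfSpaces _ _).measurableSet h).symm

/-- The integral over an isometric image of a face of an intersection of half-spaces. -/
theorem setIntegral_image_face {n : I → V} {t : I → ℝ} {j : I} (hj : n j ≠ 0) {e : V → X}
    (he : Isometry e) {k : ℕ} (hk : Module.finrank ℝ V = k) {f : X → ℝ} {g : V → ℝ}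
    (hg : Continuous g) (hgs : HasCompactSupport g) (h : EqOn g (f ∘ e) (halfSpaces n t)) :
    IntegrableOn f (e '' {v | v ∈ halfSpaces n t ∧ ⟪n j, v⟫ = t j}) μHE[k - 1] ∧
      ∫ x in e '' {v | v ∈ halfSpaces n t ∧ ⟪n j, v⟫ = t j}, f x ∂μHE[k - 1] =
        faceIntegral n g j t := by
  have himg := image_slicePoint_faceSlice t hj
  have hiso := he.comp (isometry_slicePoint (n j) (t j / ‖n j‖ ^ 2))
  have hrank := finrank_orthogonal_singleton hj
  rw [hk] at hrank
  have hm := (isClosed_faceSlice n t j).measurableSet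
  have heq : EqOn (fun z => g (slicePoint (n j) (t j / ‖n j‖ ^ 2) z))
      (f ∘ (e ∘ slicePoint (n j) (t j / ‖n j‖ ^ 2))) (faceSlice n t j) := by
    intro z hz
    have := mem_image_of_mem (slicePoint (n j) (t j / ‖n j‖ ^ 2)) hz
    rw [himg] at this
    exact h this.1
  rw [← himg, ← image_comp, integrableOn_image_isometry hiso hrank,
    setIntegral_image_isometry hiso hrank]
  exact ⟨((integrable_slicePoint hg hgs _ _).integrableOn).congr_fun heq hm,
    (setIntegral_congr_fun hm heq).symm⟩

/-- The integral over an intersection of half-spaces, of which some move and the others do not, is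
a `C¹` function of the thresholds of the former. -/
theorem contDiff_integral_halfSpaces {J K : Type*} [Fintype J] [Fintype K] {n : J ⊕ K → V}
    (β : K → ℝ) {g : V → ℝ} (hg : Continuous g) (hgs : HasCompactSupport g)
    (hn : ∀ j, n (.inl j) ≠ 0) (hnl : ∀ j l, l ≠ .inl j → n l ∉ (ℝ ∙ n (.inl j))) :
    ContDiff ℝ 1 (fun τ => ∫ v in halfSpaces n (Sum.elim τ β), g v) ∧
      ∀ τ, HasFDerivAt (fun τ => ∫ v in halfSpaces n (Sum.elim τ β), g v)
        (∑ j, (1 / ‖n (.inl j)‖ * faceIntegral n g (.inl j) (Sum.elim τ β)) •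
          ContinuousLinearMap.proj (R := ℝ) (φ := fun _ : J => ℝ) j) τ := by
  classical
  have hderiv : ∀ τ j, HasDerivAt
      (fun t => ∫ v in halfSpaces n (Sum.elim (Function.update τ j t) β), g v)
      (1 / ‖n (.inl j)‖ * faceIntegral n g (.inl j) (Sum.elim τ β)) (τ j) := by
    intro τ j
    have := hasDerivAt_integral_halfSpaces (n := n) hg hgs (Sum.inl j) (hn j) (hnl j) (Sum.elim τ β)
    simp only [Sum.update_elim_inl] at this
    exact this
  have hcont : ∀ j, Continuous fun τ =>
      1 / ‖n (.inl j)‖ * faceIntegral n g (.inl j) (Sum.elim τ β) := by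
    intro j
    have h : Continuous fun τ : J → ℝ => Sum.elim τ β := by
      refine continuous_pi fun l => ?_
      rcases l with l | f
      · exact continuous_apply l
      · exact continuous_const
    have h2 : Continuous (faceIntegral n g (.inl j)) :=
      continuous_faceIntegral (n := n) hg hgs (Sum.inl j) (hnl j)
    exact (h2.comp h).const_mul _
  exact ⟨contDiff_one_of_continuous_partial hderiv hcont,
    fun τ => hasFDerivAt_of_continuous_partial hderiv hcont τ⟩

end Faces

/-! ### Power cells inside one simplex -/

section OneSimplex

variable {d N k : ℕ} (s : Affine.Simplex ℝ (Space d) k) (y : Fin N → Space d) (i : Fin N)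

/-- The normals of the half-spaces which cut out a power cell inside a simplex, in the chart of the
simplex. -/
def cellNormal : {j : Fin N // j ≠ i} ⊕ Fin (k + 1) → vectorSpan ℝ (range s.points) :=
  Sum.elim (fun j => (2 : ℝ) • (vectorSpan ℝ (range s.points)).orthogonalProjectionOnto
    (y j - y i)) (facetNormal s)

/-- The thresholds of the bisectors of a power cell in the chart of a simplex. -/
def bisectorThreshold (ψ : Fin N → ℝ) (j : {j : Fin N // j ≠ i}) : ℝ :=
  ψ j - ψ i + (‖y j‖ ^ 2 - ‖y i‖ ^ 2 - 2 * ⟪s.points 0, y j - y i⟫)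

/-- The thresholds of all half-spaces which cut out a power cell inside a simplex, given those of
the bisectors. -/
def cellThreshold (τ : {j : Fin N // j ≠ i} → ℝ) : {j : Fin N // j ≠ i} ⊕ Fin (k + 1) → ℝ :=
  Sum.elim τ fun f => (chartBasis s).coord f 0

variable {s y i}

theorem norm_sub_sq_sub_norm_sub_sq {E : Type*} [NormedAddCommGroup E] [InnerProductSpace ℝ E]
    (x a b : E) : ‖x - a‖ ^ 2 - ‖x - b‖ ^ 2 = 2 * ⟪x, b - a⟫ - (‖b‖ ^ 2 - ‖a‖ ^ 2) := by
  rw [norm_sub_sq_real, norm_sub_sq_real, inner_sub_right]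
  ring

theorem inner_orthogonalProjectionOnto_left {E : Type*} [NormedAddCommGroup E]
    [InnerProductSpace ℝ E] (U : Submodule ℝ E) [U.HasOrthogonalProjection] (w : E) (v : U) :
    ⟪U.orthogonalProjectionOnto w, v⟫ = ⟪w, (v : E)⟫ := by
  rw [real_inner_comm, Submodule.inner_orthogonalProjectionOnto_eq_of_mem_left, real_inner_comm]

theorem inner_cellNormal_inl (j : {j : Fin N // j ≠ i}) (v : vectorSpan ℝ (range s.points)) :
    ⟪cellNormal s y i (.inl j), v⟫ = 2 * ⟪y j - y i, (v : Space d)⟫ := by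
  exact (real_inner_smul_left _ _ _).trans
    (congrArg (2 * ·) (inner_orthogonalProjectionOnto_left _ _ _))

/-- Being an identity rather than an inequality, it describes both the cell (sign) and the interface
(vanishing). -/
theorem inner_cellNormal_sub (ψ : Fin N → ℝ) (j : {j : Fin N // j ≠ i})
    (v : vectorSpan ℝ (range s.points)) :
    ⟪cellNormal s y i (.inl j), v⟫ - bisectorThreshold s y i ψ j =
      (‖chart s v - y i‖ ^ 2 + ψ i) - (‖chart s v - y j‖ ^ 2 + ψ j) := by
  have h1 := norm_sub_sq_sub_norm_sub_sq (chart s v) (y i) (y j)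
  have h2 := inner_cellNormal_inl (y := y) j v
  have h3 : ⟪chart s v, y j - y i⟫ = ⟪s.points 0, y j - y i⟫ + ⟪(v : Space d), y j - y i⟫ := by
    rw [chart, inner_add_left]
  have h4 := real_inner_comm (v : Space d) (y j - y i)
  rw [h2, bisectorThreshold]
  linarith

theorem chart_mem_powerCell (ψ : Fin N → ℝ) (v : vectorSpan ℝ (range s.points)) :
    chart s v ∈ powerCell y ψ i ↔
      ∀ j, ⟪cellNormal s y i (.inl j), v⟫ ≤ bisectorThreshold s y i ψ j := by
  constructor
  · intro h j
    have h1 := h j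
    have h2 := inner_cellNormal_sub (y := y) ψ j v
    linarith
  · intro h j
    by_cases hj : j = i
    · rw [hj]
    · have h1 := h ⟨j, hj⟩
      have h2 := inner_cellNormal_sub (y := y) ψ ⟨j, hj⟩ v
      dsimp only at h2
      linarith

theorem mem_halfSpaces_cellNormal (ψ : Fin N → ℝ) (v : vectorSpan ℝ (range s.points)) :
    v ∈ halfSpaces (cellNormal s y i) (cellThreshold s i (bisectorThreshold s y i ψ)) ↔
      chart s v ∈ powerCell y ψ i ∧
        v ∈ halfSpaces (facetNormal s) fun f => (chartBasis s).coord f 0 := by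
  rw [chart_mem_powerCell]
  exact Sum.forall

theorem powerCell_inter_simplex (ψ : Fin N → ℝ) :
    powerCell y ψ i ∩ convexHull ℝ (range s.points) =
      chart s '' halfSpaces (cellNormal s y i)
        (cellThreshold s i (bisectorThreshold s y i ψ)) := by
  rw [convexHull_eq_image_chart]
  ext x
  constructor
  · rintro ⟨hx, v, hv, rfl⟩
    exact ⟨v, (mem_halfSpaces_cellNormal ψ v).2 ⟨hx, hv⟩, rfl⟩
  · rintro ⟨v, hv, rfl⟩
    obtain ⟨h1, h2⟩ := (mem_halfSpaces_cellNormal ψ v).1 hv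
    exact ⟨h1, v, h2, rfl⟩

theorem mem_powerCell_iff_of_mem {ψ : Fin N → ℝ} {x : Space d} (hx : x ∈ powerCell y ψ i)
    (j : Fin N) : x ∈ powerCell y ψ j ↔ ‖x - y i‖ ^ 2 + ψ i = ‖x - y j‖ ^ 2 + ψ j :=
  ⟨fun h => le_antisymm (hx j) (h i), fun h l => h ▸ hx l⟩

theorem powerCell_inter_powerCell_inter_simplex (ψ : Fin N → ℝ) (j : {j : Fin N // j ≠ i}) :
    powerCell y ψ i ∩ powerCell y ψ j ∩ convexHull ℝ (range s.points) =
      chart s '' {v | v ∈ halfSpaces (cellNormal s y i)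
        (cellThreshold s i (bisectorThreshold s y i ψ)) ∧ ⟪cellNormal s y i (.inl j), v⟫ =
          cellThreshold s i (bisectorThreshold s y i ψ) (.inl j)} := by
  rw [inter_right_comm, powerCell_inter_simplex]
  have key : ∀ v : vectorSpan ℝ (range s.points),
      ⟪cellNormal s y i (.inl j), v⟫ = cellThreshold s i (bisectorThreshold s y i ψ) (.inl j) ↔
        ‖chart s v - y i‖ ^ 2 + ψ i = ‖chart s v - y j‖ ^ 2 + ψ j := fun v => by
    rw [← sub_eq_zero, ← sub_eq_zero (a := ‖chart s v - y i‖ ^ 2 + ψ i),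
      ← inner_cellNormal_sub (y := y) ψ j v]
    rfl
  ext x
  constructor
  · rintro ⟨⟨v, hv, rfl⟩, hx⟩
    refine ⟨v, ⟨hv, (key v).2 ?_⟩, rfl⟩
    exact (mem_powerCell_iff_of_mem ((mem_halfSpaces_cellNormal ψ v).1 hv).1 j).1 hx
  · rintro ⟨v, ⟨hv, hvj⟩, rfl⟩
    refine ⟨⟨v, hv, rfl⟩, ?_⟩
    exact (mem_powerCell_iff_of_mem ((mem_halfSpaces_cellNormal ψ v).1 hv).1 j).2 ((key v).1 hvj)

theorem norm_cellNormal_inl (j : {j : Fin N // j ≠ i}) :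
    ‖cellNormal s y i (.inl j)‖ =
      2 * ‖(vectorSpan ℝ (range s.points)).starProjection (y i - y j)‖ := by
  rw [cellNormal, Sum.elim_inl, norm_smul, Submodule.coe_norm,
    ← Submodule.starProjection_apply, ← neg_sub (y i), map_neg, norm_neg, Real.norm_ofNat]

theorem chart_mem_simplex (ψ : Fin N → ℝ) :
    halfSpaces (cellNormal s y i) (cellThreshold s i (bisectorThreshold s y i ψ)) ⊆
      chart s ⁻¹' convexHull ℝ (range s.points) := fun v hv => by
  rw [mem_preimage, convexHull_eq_image_chart]
  exact mem_image_of_mem _ ((mem_halfSpaces_cellNormal ψ v).1 hv).2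

variable (hy : IsGenericSimplex y s.points) (hk : 2 ≤ k)
include hy hk

theorem cellNormal_inl_ne_zero (j : {j : Fin N // j ≠ i}) : cellNormal s y i (.inl j) ≠ 0 := by
  intro h
  obtain ⟨v, hv, hne⟩ := hy.not_orthogonal_face (p := k) (by omega) le_rfl
    (Function.Embedding.refl _) j.2.symm
  have := inner_cellNormal_inl (y := y) j (⟨v, hv⟩ : vectorSpan ℝ (range s.points))
  rw [h, inner_zero_left] at this
  exact hne (by simpa using this.symm)

/-- For two bisectors this is non-proportionality. For a facet, its normal kills the facet direction
while the bisector normal does not, so the factor is `0`, contradicting a nonzero facet normal. -/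
theorem cellNormal_notMem_span (j : {j : Fin N // j ≠ i})
    (l : {j : Fin N // j ≠ i} ⊕ Fin (k + 1)) (hl : l ≠ .inl j) :
    cellNormal s y i l ∉ (ℝ ∙ cellNormal s y i (.inl j)) := by
  intro h
  obtain ⟨r, hr⟩ := Submodule.mem_span_singleton.1 h
  rcases l with l | f
  · have hjl : (j : Fin N) ≠ l := fun h => hl (congrArg Sum.inl (Subtype.ext h.symm))
    obtain ⟨v, hv, hne⟩ := hy.not_proportional hk j.2.symm l.2.symm hjl r
    refine hne ?_
    have h1 := inner_cellNormal_inl (y := y) l (⟨v, hv⟩ : vectorSpan ℝ (range s.points))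
    rw [← hr, inner_smul_left, inner_cellNormal_inl] at h1
    simp only [conj_trivial] at h1
    linarith
  -- The simplex dimension becomes `k + 2`, so the facets have dimension `k + 1 ≥ 1` and genericity
  -- applies to them.
  · obtain ⟨k, rfl⟩ : ∃ k', k = k' + 1 := ⟨k - 1, by omega⟩
    obtain ⟨k, rfl⟩ : ∃ k', k = k' + 1 := ⟨k - 1, by omega⟩
    obtain ⟨v, hv, hne⟩ := hy.not_orthogonal_face (p := k + 1) (by omega) (by omega)
      f.succAboveEmb j.2.symm
    have hv' : v ∈ vectorSpan ℝ (range s.points) :=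
      vectorSpan_mono ℝ (range_comp_subset_range _ _) hv
    have h1 := inner_facetNormal_eq_zero s f (v := ⟨v, hv'⟩) hv
    change r • cellNormal s y i (.inl j) = facetNormal s f at hr
    rw [← hr, real_inner_smul_left (cellNormal s y i (.inl j)), inner_cellNormal_inl] at h1
    have hr0 : r = 0 := by simpa [hne] using h1
    rw [hr0, zero_smul] at hr
    exact facetNormal_ne_zero s (by omega) f hr.symm

omit hk in
/-- The mass of a power cell in one simplex, and of its faces. -/
theorem IsGenericSimplex.regularity_in_simplex (hk : 2 ≤ k) {ρ : Space d → ℝ}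
    (hρ : ContinuousOn ρ (convexHull ℝ (range s.points))) (i : Fin N) :
    ContDiff ℝ 1 (fun ψ : Fin N → ℝ =>
      ∫ x in powerCell y ψ i ∩ convexHull ℝ (range s.points), ρ x ∂μHE[k]) ∧
    (∀ (ψ : Fin N → ℝ) (j : Fin N), i ≠ j →
      (vectorSpan ℝ (range s.points)).starProjection (y i - y j) ≠ 0 ∧
      IntegrableOn ρ (powerCell y ψ i ∩ powerCell y ψ j ∩ convexHull ℝ (range s.points))
        μHE[k - 1] ∧
      HasDerivAt (fun t : ℝ => ∫ x in powerCell y (Function.update ψ j t) i ∩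
          convexHull ℝ (range s.points), ρ x ∂μHE[k])
        (1 / (2 * ‖(vectorSpan ℝ (range s.points)).starProjection (y i - y j)‖) *
          ∫ x in powerCell y ψ i ∩ powerCell y ψ j ∩ convexHull ℝ (range s.points),
            ρ x ∂μHE[k - 1]) (ψ j)) ∧
    (∀ ψ : Fin N → ℝ,
      HasDerivAt (fun t : ℝ => ∫ x in powerCell y (Function.update ψ i t) i ∩
          convexHull ℝ (range s.points), ρ x ∂μHE[k])
        (-∑ j ∈ Finset.univ.erase i,
          1 / (2 * ‖(vectorSpan ℝ (range s.points)).starProjection (y i - y j)‖) *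
            ∫ x in powerCell y ψ i ∩ powerCell y ψ j ∩ convexHull ℝ (range s.points),
              ρ x ∂μHE[k - 1]) (ψ i)) := by
  have hcomp : IsCompact (convexHull ℝ (range s.points)) :=
    (finite_range _).isCompact_convexHull ℝ
  have hch := isometry_chart s
  -- The density matters only on the simplex, whereas the half-space calculus needs a continuous
  -- compactly supported integrand on the whole chart.
  obtain ⟨g, hg, hgs, hgeq⟩ := exists_hasCompactSupport_eqOn
    (hch.isClosedEmbedding.isCompact_preimage hcomp)
    (hρ.comp hch.continuous.continuousOn (mapsTo_preimage _ _))
  have hV := finrank_vectorSpan_simplex s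
  have hnj := fun j => cellNormal_inl_ne_zero (i := i) hy hk j
  have hnl := fun j => cellNormal_notMem_span (i := i) hy hk j
  obtain ⟨hF0, hF1⟩ := contDiff_integral_halfSpaces (fun f => (chartBasis s).coord f 0) hg hgs
    hnj hnl
  have hcell : ∀ ψ, ∫ x in powerCell y ψ i ∩ convexHull ℝ (range s.points), ρ x ∂μHE[k] =
      ∫ v in halfSpaces (cellNormal s y i) (Sum.elim (bisectorThreshold s y i ψ)
        fun f => (chartBasis s).coord f 0), g v := by
    intro ψ
    rw [powerCell_inter_simplex]
    exact setIntegral_image_halfSpaces hch hV (hgeq.mono (chart_mem_simplex ψ))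
  have hface : ∀ (ψ : Fin N → ℝ) (j : {j : Fin N // j ≠ i}),
      IntegrableOn ρ (powerCell y ψ i ∩ powerCell y ψ j ∩ convexHull ℝ (range s.points))
        μHE[k - 1] ∧
      1 / (2 * ‖(vectorSpan ℝ (range s.points)).starProjection (y i - y j)‖) *
        ∫ x in powerCell y ψ i ∩ powerCell y ψ j ∩ convexHull ℝ (range s.points),
          ρ x ∂μHE[k - 1] = 1 / ‖cellNormal s y i (.inl j)‖ *
            faceIntegral (cellNormal s y i) g (.inl j) (Sum.elim (bisectorThreshold s y i ψ)
              fun f => (chartBasis s).coord f 0) := by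
    intro ψ j
    obtain ⟨h1, h2⟩ := setIntegral_image_face (hnj j) hch hV hg hgs
      (hgeq.mono (chart_mem_simplex ψ))
    rw [powerCell_inter_powerCell_inter_simplex, norm_cellNormal_inl]
    exact ⟨h1, congrArg _ h2⟩
  refine ⟨?_, ?_, ?_⟩
  · simp only [hcell]
    refine hF0.comp ?_
    refine contDiff_pi.2 fun j => ?_
    unfold bisectorThreshold
    fun_prop
  · intro ψ j hij
    let j' : {j : Fin N // j ≠ i} := ⟨j, hij.symm⟩
    refine ⟨fun h => hnj j' ?_, (hface ψ j').1, ?_⟩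
    · rw [← norm_eq_zero, norm_cellNormal_inl, h, norm_zero, mul_zero]
    · simp only [hcell]
      rw [(hface ψ j').2]
      -- The weight `ψ j` moves only the bisector with `j`, at unit rate.
      have hτ : HasDerivAt (fun t : ℝ => bisectorThreshold s y i (Function.update ψ j t))
          (Pi.single j' 1) (ψ j) := by
        refine hasDerivAt_pi.2 fun l => ?_
        simp only [bisectorThreshold, Function.update_of_ne hij]
        by_cases hl : l = j'
        · subst hl
          simpa [j'] using ((hasDerivAt_id (ψ j)).sub_const (ψ i)).add_const
            (‖y j‖ ^ 2 - ‖y i‖ ^ 2 - 2 * ⟪s.points 0, y j - y i⟫)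
        · have : (l : Fin N) ≠ j := fun h => hl (Subtype.ext h)
          simp only [Function.update_of_ne this, Pi.single_eq_of_ne hl]
          exact hasDerivAt_const _ _
      have hF2 := hF1 (bisectorThreshold s y i (Function.update ψ j (ψ j)))
      have := hF2.comp_hasDerivAt (ψ j) hτ
      refine this.congr_deriv ?_
      simp [Function.update_eq_self, Pi.single_apply]
  · intro ψ
    simp only [hcell]
    -- The weight `ψ i` enters every threshold with coefficient `-1`, so the chain rule gives minus
    -- the sum of all face terms.
    have hτ : HasDerivAt (fun t : ℝ => bisectorThreshold s y i (Function.update ψ i t))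
        (fun _ => -1) (ψ i) := by
      refine hasDerivAt_pi.2 fun l => ?_
      simp only [bisectorThreshold, Function.update_self, Function.update_of_ne l.2]
      exact ((hasDerivAt_id (ψ i)).const_sub (ψ l)).add_const _
    have hF2 := hF1 (bisectorThreshold s y i (Function.update ψ i (ψ i)))
    have := hF2.comp_hasDerivAt (ψ i) hτ
    refine this.congr_deriv ?_
    have hsum : ∀ f : Fin N → ℝ, ∑ j ∈ Finset.univ.erase i, f j = ∑ j : {j // j ≠ i}, f j :=
      fun f => Finset.sum_subtype _ (by simp) f
    rw [hsum, Finset.sum_congr rfl fun j _ => (hface ψ j).2]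
    simp [Function.update_eq_self]

end OneSimplex

/-! ### Summing over the simplices -/

section SimplicialMeasure

variable {ι : Type*} {d N : ℕ}

theorem isClosed_powerCell (y : Fin N → Space d) (ψ : Fin N → ℝ) (i : Fin N) :
    IsClosed (powerCell y ψ i) := by
  simp only [powerCell, ofPred_forall]
  exact isClosed_iInter fun l => isClosed_le (by fun_prop) (by fun_prop)

theorem isCompact_body (S : SimplexSoup ι d) (a : ι) : IsCompact (S.body a) :=
  (finite_range _).isCompact_convexHull ℝ

theorem integrableOn_simplex {k : ℕ} (s : Affine.Simplex ℝ (Space d) k) {f : Space d → ℝ}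
    (hf : ContinuousOn f (convexHull ℝ (range s.points))) :
    IntegrableOn f (convexHull ℝ (range s.points)) μHE[k] := by
  have hch := isometry_chart s
  have himg := convexHull_eq_image_chart s
  have hK : IsCompact (halfSpaces (facetNormal s) fun f => (chartBasis s).coord f 0) := by
    have h := hch.isClosedEmbedding.isCompact_preimage
      ((finite_range s.points).isCompact_convexHull ℝ)
    rwa [himg, hch.injective.preimage_image] at h
  rw [himg] at hf ⊢
  rw [integrableOn_image_isometry hch (finrank_vectorSpan_simplex s)]
  exact (hf.comp hch.continuous.continuousOn (mapsTo_image _ _)).integrableOn_compact hK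

theorem lag_inter_body (S : SimplexSoup ι d) (y : Fin N → Space d) (ψ : Fin N → ℝ) (i : Fin N)
    (a : ι) : lag S y ψ i ∩ S.body a = powerCell y ψ i ∩ S.body a := by
  have h : S.body a ⊆ S.support := subset_iUnion S.body a
  rw [lag, inter_assoc, inter_eq_right.2 h]

theorem lagInter_inter_body (S : SimplexSoup ι d) (y : Fin N → Space d) (ψ : Fin N → ℝ)
    (i j : Fin N) (a : ι) :
    lagInter S y ψ i j ∩ S.body a = powerCell y ψ i ∩ powerCell y ψ j ∩ S.body a := by
  rw [lagInter, inter_inter_distrib_right, lag_inter_body, lag_inter_body,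
    ← inter_inter_distrib_right]

variable [Fintype ι] {S : SimplexSoup ι d} {ρ : ι → Space d → ℝ} {μ : Measure (Space d)}

/-- Densities continuous on compact simplices are integrable, so the mass is a finite sum of real
integrals, to which the calculus above applies. -/
theorem IsRegularSimplicialMeasure.measure_eq (hμ : IsRegularSimplicialMeasure S ρ μ)
    {B : Set (Space d)} (hB : MeasurableSet B) :
    μ B = ∑ a, ENNReal.ofReal (∫ x in B ∩ S.body a, ρ a x ∂μHE[S.dim a]) := by
  rw [hμ.apply_eq B hB]
  refine Finset.sum_congr rfl fun a _ => (ofReal_integral_eq_lintegral_ofReal ?_ ?_).symm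
  · exact (integrableOn_simplex (S.simplex a) (hμ.density_continuous a)).mono_set
      inter_subset_right
  · exact ae_restrict_of_forall_mem (hB.inter (isCompact_body S a).measurableSet)
      fun x hx => hμ.density_nonneg a x hx.2

theorem IsRegularSimplicialMeasure.isFiniteMeasure (hμ : IsRegularSimplicialMeasure S ρ μ) :
    IsFiniteMeasure μ :=
  ⟨by
    rw [hμ.measure_eq MeasurableSet.univ]
    exact ENNReal.sum_lt_top.2 fun a _ => ENNReal.ofReal_lt_top⟩

theorem IsRegularSimplicialMeasure.massMap_eq (hμ : IsRegularSimplicialMeasure S ρ μ)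
    (y : Fin N → Space d) (ψ : Fin N → ℝ) (i : Fin N) :
    massMap S μ y ψ i = ∑ a, ∫ x in powerCell y ψ i ∩ S.body a, ρ a x ∂μHE[S.dim a] := by
  have hm : MeasurableSet (lag S y ψ i) := (isClosed_powerCell y ψ i).measurableSet.inter
    (MeasurableSet.iUnion fun a => (isCompact_body S a).measurableSet)
  rw [massMap, hμ.measure_eq hm, ENNReal.toReal_sum fun a _ => ENNReal.ofReal_ne_top]
  refine Finset.sum_congr rfl fun a _ => ?_
  rw [lag_inter_body, ENNReal.toReal_ofReal]
  exact setIntegral_nonneg ((isClosed_powerCell y ψ i).inter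
    (isCompact_body S a).isClosed).measurableSet fun x hx => hμ.density_nonneg a x hx.2

end SimplicialMeasure

end SemiDiscrete

end

theorem mainTheorem2 {ι : Type*} [Fintype ι] {d N : ℕ}
    (S : SemiDiscrete.SimplexSoup ι d) (ρ : ι → SemiDiscrete.Space d → ℝ)
    (μ : Measure (SemiDiscrete.Space d)) (y : Fin N → SemiDiscrete.Space d)
    (hμ : SemiDiscrete.IsRegularSimplicialMeasure S ρ μ)
    (hy : SemiDiscrete.IsGeneric y S) :
    -- the masses are finite and the map `G` is of class `C¹` on all of `ℝ^N`
    IsFiniteMeasure μ ∧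
    ContDiff ℝ 1 (SemiDiscrete.massMap S μ y) ∧
    -- the off-diagonal partial derivatives; no factor is a division by zero,
    -- and all the integrals converge
    (∀ (ψ : Fin N → ℝ) (i j : Fin N), i ≠ j →
      (∀ a, (S.tangent a).starProjection (y i - y j) ≠ 0) ∧
      (∀ a, IntegrableOn (ρ a) (SemiDiscrete.lagInter S y ψ i j ∩ S.body a) μHE[S.dim a - 1]) ∧
      HasDerivAt (fun t : ℝ => SemiDiscrete.massMap S μ y (Function.update ψ j t) i)
        (SemiDiscrete.interfaceMass S ρ y ψ i j) (ψ j)) ∧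
    -- the diagonal partial derivatives
    (∀ (ψ : Fin N → ℝ) (i : Fin N),
      HasDerivAt (fun t : ℝ => SemiDiscrete.massMap S μ y (Function.update ψ i t) i)
        (-∑ j ∈ Finset.univ.erase i, SemiDiscrete.interfaceMass S ρ y ψ i j) (ψ i)) := by
  have hreg := fun a i => (hy a).regularity_in_simplex (hμ.two_le_dim a)
    (hμ.density_continuous a) i
  refine ⟨hμ.isFiniteMeasure, contDiff_pi.2 fun i => ?_, fun ψ i j hij => ⟨fun a => ?_, fun a => ?_,
    ?_⟩, fun ψ i => ?_⟩
  · simp only [hμ.massMap_eq]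
    exact ContDiff.sum fun a _ => (hreg a i).1
  · exact ((hreg a i).2.1 ψ j hij).1
  · rw [SemiDiscrete.lagInter_inter_body]
    exact ((hreg a i).2.1 ψ j hij).2.1
  · simp only [hμ.massMap_eq, SemiDiscrete.interfaceMass, SemiDiscrete.lagInter_inter_body]
    exact HasDerivAt.fun_sum fun a _ => ((hreg a i).2.1 ψ j hij).2.2
  · simp only [hμ.massMap_eq, SemiDiscrete.interfaceMass, SemiDiscrete.lagInter_inter_body]
    rw [Finset.sum_comm, ← Finset.sum_neg_distrib]
    exact HasDerivAt.fun_sum fun a _ => (hreg a i).2.2 ψ
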